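/- Let $p=(p_k)_{k\ge 0}$ be a bounded sequence of strictly positive real numbers and let $q=(q_n)_{n\ge 0}$ be a non-decreasing bounded sequence of strictly positive real numbers. All sequences and matrices below are real and indexed by $\mathbb N=\{0,1,2,\dots\}$. Put $$\ell_\infty(q)=\{x:\sup_n|x_n|^{q_n}<\infty\},\quad c_0(q)=\{x:\lim_{n}|x_n|^{q_n}=0\},\quad c(q)=\{x:\exists\, l\in\mathbb R,\ \lim_{n}|x_n-l|^{q_n}=0\}.$$ Let $f_0=f_1=1$, $f_n=f_{n-1}+f_{n-2}$ for $n\ge2$, let $(\widehat Fx)_0=\frac{f_0}{f_1}x_0$ and $(\widehat Fx)_n=\frac{f_n}{f_{n+1}}x_n-\frac{f_{n+1}}{f_n}x_{n-1}$ for $n\ge 1$, and let $$c(\widehat F,p)=\{x:\exists\, l\in\mathbb R,\ \lim_{n\to\infty}|(\widehat Fx)_n-l|^{p_n}=0\}.$$ For sets $X,Y$ of sequences, $(X:Y)$ is the set of infinite matrices $A=(a_{nk})$ such that, for every $x\in X$, the series $(Ax)_n=\sum_{k=0}^\infty a_{nk}x_k$ converges for every $n$ and $((Ax)_n)_n\in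 Y$. For an infinite matrix $A=(a_{nk})$ write $$e^{(n)}_{mk}=\sum_{j=k}^{m}\frac{f_{j+1}^2}{f_kf_{k+1}}a_{nj}\ \ (=0 \text{ if } k>m),\qquad e_{nk}=\lim_{m\to\infty}e^{(n)}_{mk},$$ the limits $e_{nk}$ existing whenever condition (1) below holds. $L$ and $M$ denote positive integers. Consider the following conditions. 1. For every $n$ there is a real sequence $(\alpha_k)$ with $\lim_{m\to\infty}|e^{(n)}_{mk}-\alpha_k|=0$ for all $k$. 2. For every $n$ there is $M$ with $\sup_m\sum_{k=0}^m|e^{(n)}_{mk}|M^{-1/p_k}<\infty$. 3. For every $n$ and every $L$ there is $M$ with $\sup_m\sum_{k=0}^m|e^{(n)}_{mk}|L^{1/q_n}M^{-1/p_k}<\infty$. 4. For every $n$ there is $\alpha\in\mathbb R$ with $\lim_{m\to\infty}\left|\sum_{k=0}^m e^{(n)}_{mk}-\alpha\right|=0$. 5. There is $M$ with $\sup_{n}\sup_{K}\left(\sum_{k\in K}|e_{nk}|M^{-1/p_k}\right)^{q_n}<\infty$, where $K$ runs over the finite subsets of $\mathbb N$. 6. $\lim_{n\to\infty}|e_{nk}|^{q_n}=0$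 for all $k$. 7. For every $L$ there is $M$ with $\sup_n\sum_k|e_{nk}|L^{1/q_n}M^{-1/p_k}<\infty$. 8. There is a real sequence $(\alpha_k)$ such that $\lim_{n\to\infty}|e_{nk}-\alpha_k|^{q_n}=0$ for all $k$ and, for every $L$, there is $M$ with $\sup_n\sum_k|e_{nk}-\alpha_k|L^{1/q_n}M^{-1/p_k}<\infty$. 9. There is $M$ with $\sup_n\sum_k|e_{nk}|M^{-1/p_k}<\infty$. 10. The series $\sum_k e_{nk}$ converges for every $n$, and $\sup_n\left|\sum_ke_{nk}\right|^{q_n}<\infty$. 11. The series $\sum_k e_{nk}$ converges for every $n$, and $\lim_{n\to\infty}\left|\sum_ke_{nk}\right|^{q_n}=0$. 12. The series $\sum_k e_{nk}$ converges for every $n$, and there is $\alpha\in\mathbb R$ with $\lim_{n\to\infty}\left|\sum_ke_{nk}-\alpha\right|^{q_n}=0$. Then for every infinite real matrix $A$: (i) $A\in(c(\widehat F,p):\ell_\infty(q))$ if and only if (1), (2), (3), (4), (5) and (10) hold. (ii) $A\in(c(\widehat F,p):c_0(q))$ if and only if (1), (2), (3), (4), (6), (7) and (11) hold. (iii) $A\in(c(\widehat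 F,p):c(q))$ if and only if (1), (2), (3), (4), (8), (9) and (12) hold. -/

import Mathlib

open Filter Topology

noncomputable section

namespace FibSeq

/-- The Fibonacci numbers normalised by `f 0 = f 1 = 1`, as real numbers. -/
def f (n : ℕ) : ℝ := (Nat.fib (n + 1) : ℝ)

/-- Maddox's space `c(p)` of real sequences. -/
def maddoxC (p : ℕ → ℝ) : Set (ℕ → ℝ) :=
  {x | ∃ l : ℝ, Tendsto (fun k => |x k - l| ^ p k) atTop (𝓝 0)}

/-- Maddox's space `c₀(p)` of real sequences. -/
def maddoxC0 (p : ℕ → ℝ) : Set (ℕ → ℝ) :=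
  {x | Tendsto (fun k => |x k| ^ p k) atTop (𝓝 0)}

/-- Maddox's space `ℓ_∞(p)` of real sequences. -/
def maddoxLinf (p : ℕ → ℝ) : Set (ℕ → ℝ) :=
  {x | BddAbove (Set.range fun k => |x k| ^ p k)}

/-- The `F̂`-transform of a sequence; the entry `x_{-1}` is absent in row `0`. -/
def fibTransform (x : ℕ → ℝ) : ℕ → ℝ
  | 0 => f 0 / f 1 * x 0
  | n + 1 => f (n + 1) / f (n + 2) * x (n + 1) - f (n + 2) / f (n + 1) * x n

/-- The space `c(F̂,p)`: all sequences whose `F̂`-transform lies in `c(p)`. -/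
def fibC (p : ℕ → ℝ) : Set (ℕ → ℝ) :=
  {x | fibTransform x ∈ maddoxC p}

/-- The series `∑ u_k` (in the usual order, convergence possibly conditional) converges to `s`. -/
def SeriesConvergesTo (u : ℕ → ℝ) (s : ℝ) : Prop :=
  Tendsto (fun N => ∑ k ∈ Finset.range N, u k) atTop (𝓝 s)

/-- The class `(X : Y)`: every series `∑_k a_{nk} x_k` with `x ∈ X` converges, and the sequence
of the sums is in `Y`. -/
def matrixClass (X Y : Set (ℕ → ℝ)) : Set (ℕ → ℕ → ℝ) :=
  {A | ∀ x ∈ X, ∃ y ∈ Y, ∀ n, SeriesConvergesTo (fun k => A n k * x k) (y n)}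

/-- `e^{(n)}_{mk} = ∑_{j=k}^m f_{j+1}² / (f_k f_{k+1}) a_{nj}` (which is `0` for `k > m`). -/
def partialE (A : ℕ → ℕ → ℝ) (n m k : ℕ) : ℝ :=
  ∑ j ∈ Finset.Icc k m, f (j + 1) ^ 2 / (f k * f (k + 1)) * A n j

/-- `e_{nk} = lim_m e^{(n)}_{mk}`; used only together with `ColumnLimits A`, which says that all
these limits exist. -/
def limitE (A : ℕ → ℕ → ℝ) (n k : ℕ) : ℝ :=
  limUnder atTop (fun m => partialE A n m k)

/-- For every `n` there is `(α_k)` with `lim_m |e^{(n)}_{mk} - α_k| = 0` for all `k`. -/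
def ColumnLimits (A : ℕ → ℕ → ℝ) : Prop :=
  ∀ n, ∃ α : ℕ → ℝ, ∀ k, Tendsto (fun m => |partialE A n m k - α k|) atTop (𝓝 0)

/-- For every `n`: `∃ M, sup_m ∑_{k ≤ m} |e^{(n)}_{mk}| M^{-1/p_k} < ∞`. -/
def PartialBounded (A : ℕ → ℕ → ℝ) (p : ℕ → ℝ) : Prop :=
  ∀ n, ∃ M : ℕ, 1 ≤ M ∧ BddAbove (Set.range fun m =>
    ∑ k ∈ Finset.range (m + 1), |partialE A n m k| * (M : ℝ) ^ (-(1 / p k)))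

/-- For every `n`: `∀ L, ∃ M, sup_m ∑_{k ≤ m} |e^{(n)}_{mk}| L^{1/q_n} M^{-1/p_k} < ∞`. -/
def PartialBoundedWeighted (A : ℕ → ℕ → ℝ) (p q : ℕ → ℝ) : Prop :=
  ∀ n, ∀ L : ℕ, 1 ≤ L → ∃ M : ℕ, 1 ≤ M ∧ BddAbove (Set.range fun m =>
    ∑ k ∈ Finset.range (m + 1),
      |partialE A n m k| * (L : ℝ) ^ (1 / q n) * (M : ℝ) ^ (-(1 / p k)))

/-- For every `n` there is `α` with `lim_m |∑_{k ≤ m} e^{(n)}_{mk} - α| = 0`. -/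
def PartialRowSums (A : ℕ → ℕ → ℝ) : Prop :=
  ∀ n, ∃ α : ℝ,
    Tendsto (fun m => |(∑ k ∈ Finset.range (m + 1), partialE A n m k) - α|) atTop (𝓝 0)

/-- `sup_n ∑_k u_{nk} < ∞`, for non-negative terms `u_{nk}`. -/
def SupSumFinite (u : ℕ → ℕ → ℝ) : Prop :=
  ∃ C : ℝ, ∀ n, Summable (u n) ∧ ∑' k, u n k ≤ C

/-- `∃ M, sup_{n, K} (∑_{k ∈ K} |e_{nk}| M^{-1/p_k})^{q_n} < ∞`, `K` over the finite subsets
of `ℕ`. -/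
def FiniteSumsBounded (e : ℕ → ℕ → ℝ) (p q : ℕ → ℝ) : Prop :=
  ∃ M : ℕ, 1 ≤ M ∧ ∃ C : ℝ, ∀ (n : ℕ) (K : Finset ℕ),
    (∑ k ∈ K, |e n k| * (M : ℝ) ^ (-(1 / p k))) ^ q n ≤ C

end FibSeq

end

noncomputable section

open scoped ZeroAtInfty

namespace FibSeq

/-! Write y for the transform of x, w_k = 1/(f_k f_{k+1}) and T_n(N) = ∑_{j<N} f_{j+1}² a_{nj}. The
transform inverts to x_n = f_{n+1}² ∑_{k≤n} w_k y_k, so x ↦ y maps c(F̂,p) onto c(p). Condition (1)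
says that each T_n has a limit S_n, and then e_{nk} = (S_n - T_n(k)) w_k. By Abel summation the N-th
partial sums of ∑ a_{nj} x_j and ∑ e_{nk} y_k differ by (T_n(N) - S_n) ∑_{k<N} w_k y_k, which tends
to 0 because w is summable and y is bounded (`seriesConvergesTo_iff`). Hence A is in (c(F̂,p) : Y)
iff (1) holds and (e_{nk}) is in (c(p) : Y); conditions (2)-(4) are then automatic.

Since c(p) is c₀(p) plus the constants, a linear Y leaves a condition on row sums and the class
(c₀(p) : Y). Sufficiency there is weighted domination and a Toeplitz argument. Necessity is a Baire
category argument, `exists_uniform_tail_bound`: c₀(p) is parametrised by the Banach space of null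
sequences through y_k = sgn(z_k)|z_k|^{1/p_k}, and although this map is nonlinear, the difference of
two values of a functional isolates finitely many coordinates. The targets c₀(q) and c(q) reduce to
bounded targets by rescaling rows and subtracting column limits. -/

/-! ### Maddox's spaces: descriptions without the outer exponent, linearity. -/

lemma rpow_le_of_abs_le {a C r : ℝ} (hr : 0 < r) (hC : 0 ≤ C) (h : |a| ≤ C ^ (1 / r)) :
    |a| ^ r ≤ C := by
  calc |a| ^ r ≤ (C ^ (1 / r)) ^ r := Real.rpow_le_rpow (abs_nonneg _) h hr.le
    _ = C := by rw [← Real.rpow_mul hC, one_div_mul_cancel hr.ne', Real.rpow_one]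

lemma le_rpow_of_rpow_le {a C r : ℝ} (hr : 0 < r) (ha : 0 ≤ a) (h : a ^ r ≤ C) :
    a ≤ C ^ (1 / r) := by
  calc a = (a ^ r) ^ (1 / r) := by
        rw [← Real.rpow_mul ha, mul_one_div_cancel hr.ne', Real.rpow_one]
    _ ≤ C ^ (1 / r) := Real.rpow_le_rpow (Real.rpow_nonneg ha _) h (by positivity)

/-- Boundedness of the exponents allows a constant factor to be absorbed into the base of a power
1/r. -/
lemma le_rpow_rpow_one_div {D H r : ℝ} (hD : 1 ≤ D) (hr : 0 < r) (hH : r ≤ H) :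
    D ≤ (D ^ H) ^ (1 / r) := by
  rw [← Real.rpow_mul (by linarith)]
  apply Real.self_le_rpow_of_one_le hD
  rw [mul_one_div, le_div_iff₀ hr]
  linarith

/-- Taking p_k-th roots turns smallness of |x_k|^{p_k} into a family of conditions homogeneous in x.
Linearity of the space and the weights in the matrix conditions both come from this form. -/
lemma mem_maddoxC0_iff {p : ℕ → ℝ} (hp : ∀ k, 0 < p k) (hpb : BddAbove (Set.range p))
    {x : ℕ → ℝ} :
    x ∈ maddoxC0 p ↔
      ∀ L : ℕ, 1 ≤ L → Tendsto (fun k => |x k| * (L : ℝ) ^ (1 / p k)) atTop (𝓝 0) := by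
  obtain ⟨H, hH⟩ := hpb
  have hH : ∀ k, p k ≤ H := fun k => hH ⟨k, rfl⟩
  have hH0 : 0 < H := (hp 0).trans_le (hH 0)
  constructor
  · intro hx L hL
    have hL0 : (0 : ℝ) < L := by exact_mod_cast hL
    rw [Metric.tendsto_atTop]
    intro ε hε
    -- The cap at 1 gives δ^{H/p_k} ≤ δ, as H/p_k ≥ 1.
    set δ : ℝ := min (ε / 2) 1 with hδ
    have hδ0 : 0 < δ := by positivity
    have hδ1 : δ ≤ 1 := min_le_right _ _
    have hev : ∀ᶠ k in atTop, |x k| ^ p k < δ ^ H / L := by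
      have : Tendsto (fun k => |x k| ^ p k) atTop (𝓝 0) := hx
      exact this.eventually (gt_mem_nhds (by positivity))
    obtain ⟨N, hN⟩ := eventually_atTop.1 hev
    refine ⟨N, fun k hk => ?_⟩
    have h1 := le_rpow_of_rpow_le (hp k) (abs_nonneg _) (hN k hk).le
    rw [Real.div_rpow (by positivity) hL0.le, le_div_iff₀ (by positivity)] at h1
    have h2 : (δ ^ H) ^ (1 / p k) ≤ δ := by
      rw [← Real.rpow_mul hδ0.le]
      calc δ ^ (H * (1 / p k)) ≤ δ ^ (1 : ℝ) := by
            apply Real.rpow_le_rpow_of_exponent_ge hδ0 hδ1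
            rw [mul_one_div, le_div_iff₀ (hp k)]
            linarith [hH k]
        _ = δ := Real.rpow_one _
    rw [Real.dist_eq, sub_zero, abs_of_nonneg (by positivity)]
    have := min_le_left (ε / 2) 1
    linarith
  · intro h
    show Tendsto (fun k => |x k| ^ p k) atTop (𝓝 0)
    rw [Metric.tendsto_atTop]
    intro ε hε
    obtain ⟨L, hL⟩ := exists_nat_gt (1 / ε)
    have hL0 : (0 : ℝ) < L := (by positivity : (0 : ℝ) < 1 / ε).trans hL
    have hL1 : 1 ≤ L := by exact_mod_cast hL0
    have hev := (h L hL1).eventually (gt_mem_nhds zero_lt_one)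
    obtain ⟨N, hN⟩ := eventually_atTop.1 hev
    refine ⟨N, fun k hk => ?_⟩
    rw [Real.dist_eq, sub_zero, abs_of_nonneg (by positivity)]
    have h1 : |x k| ≤ (1 / (L : ℝ)) ^ (1 / p k) := by
      rw [Real.div_rpow zero_le_one hL0.le, Real.one_rpow, le_div_iff₀ (by positivity)]
      exact (hN k hk).le
    have h2 := rpow_le_of_abs_le (hp k) (by positivity) h1
    refine h2.trans_lt ?_
    rw [div_lt_iff₀ hL0]
    rw [div_lt_iff₀ hε] at hL
    linarith

lemma tendsto_zero_of_mem_maddoxC0 {p : ℕ → ℝ} (hp : ∀ k, 0 < p k)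
    (hpb : BddAbove (Set.range p)) {x : ℕ → ℝ} (hx : x ∈ maddoxC0 p) :
    Tendsto x atTop (𝓝 0) := by
  have := (mem_maddoxC0_iff hp hpb).1 hx 1 le_rfl
  simp only [Nat.cast_one, Real.one_rpow, mul_one] at this
  exact (tendsto_zero_iff_abs_tendsto_zero _).2 this

lemma tendsto_of_mem_maddoxC {p : ℕ → ℝ} (hp : ∀ k, 0 < p k)
    (hpb : BddAbove (Set.range p)) {y : ℕ → ℝ} (hy : y ∈ maddoxC p) :
    ∃ l, Tendsto y atTop (𝓝 l) := by
  obtain ⟨l, hl⟩ := hy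
  exact ⟨l, tendsto_sub_nhds_zero_iff.1
    (tendsto_zero_of_mem_maddoxC0 (x := fun k => y k - l) hp hpb hl)⟩

lemma mem_maddoxLinf_iff {q : ℕ → ℝ} (hq : ∀ n, 0 < q n) {x : ℕ → ℝ} :
    x ∈ maddoxLinf q ↔ ∃ C : ℝ, 1 ≤ C ∧ ∀ n, |x n| ≤ C ^ (1 / q n) := by
  constructor
  · rintro ⟨C, hC⟩
    refine ⟨max C 1, le_max_right _ _, fun n => le_rpow_of_rpow_le (hq n) (abs_nonneg _) ?_⟩
    exact (hC ⟨n, rfl⟩).trans (le_max_left _ _)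
  · rintro ⟨C, hC1, hC⟩
    refine ⟨C, ?_⟩
    rintro _ ⟨n, rfl⟩
    exact rpow_le_of_abs_le (hq n) (by linarith) (hC n)

lemma maddoxC0_add {p : ℕ → ℝ} (hp : ∀ k, 0 < p k) (hpb : BddAbove (Set.range p))
    {x y : ℕ → ℝ} (hx : x ∈ maddoxC0 p) (hy : y ∈ maddoxC0 p) :
    (fun k => x k + y k) ∈ maddoxC0 p := by
  rw [mem_maddoxC0_iff hp hpb] at *
  intro L hL
  have h := (hx L hL).add (hy L hL)
  rw [add_zero] at h
  refine squeeze_zero (fun k => by positivity) (fun k => ?_) h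
  rw [← add_mul]
  exact mul_le_mul_of_nonneg_right (abs_add_le _ _) (by positivity)

lemma maddoxC0_smul {p : ℕ → ℝ} (hp : ∀ k, 0 < p k) (hpb : BddAbove (Set.range p))
    {x : ℕ → ℝ} (c : ℝ) (hx : x ∈ maddoxC0 p) :
    (fun k => c * x k) ∈ maddoxC0 p := by
  rw [mem_maddoxC0_iff hp hpb] at *
  intro L hL
  have h := (hx L hL).const_mul |c|
  rw [mul_zero] at h
  refine h.congr fun k => ?_
  rw [abs_mul]; ring

lemma maddoxC_add {p : ℕ → ℝ} (hp : ∀ k, 0 < p k) (hpb : BddAbove (Set.range p))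
    {x y : ℕ → ℝ} (hx : x ∈ maddoxC p) (hy : y ∈ maddoxC p) :
    (fun k => x k + y k) ∈ maddoxC p := by
  obtain ⟨l, hl⟩ := hx
  obtain ⟨l', hl'⟩ := hy
  refine ⟨l + l', ?_⟩
  have h : Tendsto (fun k => |(x k - l) + (y k - l')| ^ p k) atTop (𝓝 0) :=
    maddoxC0_add (x := fun k => x k - l) (y := fun k => y k - l') hp hpb hl hl'
  refine h.congr fun k => ?_
  congr 2; ring

lemma maddoxC_smul {p : ℕ → ℝ} (hp : ∀ k, 0 < p k) (hpb : BddAbove (Set.range p))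
    {x : ℕ → ℝ} (c : ℝ) (hx : x ∈ maddoxC p) :
    (fun k => c * x k) ∈ maddoxC p := by
  obtain ⟨l, hl⟩ := hx
  refine ⟨c * l, ?_⟩
  have h : Tendsto (fun k => |c * (x k - l)| ^ p k) atTop (𝓝 0) :=
    maddoxC0_smul (x := fun k => x k - l) hp hpb c hl
  refine h.congr fun k => ?_
  congr 2; ring

lemma mul_rpow_le {q : ℕ → ℝ} (hq : ∀ n, 0 < q n) {H : ℝ} (hH : ∀ n, q n ≤ H) {C D : ℝ}
    (hC : 1 ≤ C) (hD : 1 ≤ D) (n : ℕ) : D * C ^ (1 / q n) ≤ (D ^ H * C) ^ (1 / q n) := by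
  rw [Real.mul_rpow (by positivity) (by linarith)]
  exact mul_le_mul_of_nonneg_right (le_rpow_rpow_one_div hD (hq n) (hH n)) (by positivity)

lemma one_le_rpow_mul {C D H : ℝ} (hC : 1 ≤ C) (hD : 1 ≤ D) (hH : 0 ≤ H) : 1 ≤ D ^ H * C :=
  one_le_mul_of_one_le_of_one_le (Real.one_le_rpow hD hH) hC

lemma mem_maddoxLinf_of_le_mul {q : ℕ → ℝ} (hq : ∀ n, 0 < q n) (hqb : BddAbove (Set.range q))
    {x : ℕ → ℝ} {C D : ℝ} (hC : 1 ≤ C) (hx : ∀ n, |x n| ≤ D * C ^ (1 / q n)) :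
    x ∈ maddoxLinf q := by
  obtain ⟨H, hH⟩ := hqb
  have hH : ∀ k, q k ≤ H := fun k => hH ⟨k, rfl⟩
  rw [mem_maddoxLinf_iff hq]
  have hD : 1 ≤ max D 1 := le_max_right _ _
  refine ⟨(max D 1) ^ H * C, one_le_rpow_mul hC hD ((hq 0).le.trans (hH 0)), fun n => ?_⟩
  refine (hx n).trans (le_trans ?_ (mul_rpow_le hq hH hC hD n))
  exact mul_le_mul_of_nonneg_right (le_max_left _ _) (by positivity)

lemma maddoxLinf_add {q : ℕ → ℝ} (hq : ∀ n, 0 < q n) (hqb : BddAbove (Set.range q))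
    {x y : ℕ → ℝ} (hx : x ∈ maddoxLinf q) (hy : y ∈ maddoxLinf q) :
    (fun k => x k + y k) ∈ maddoxLinf q := by
  obtain ⟨C, hC, hx⟩ := (mem_maddoxLinf_iff hq).1 hx
  obtain ⟨C', hC', hy⟩ := (mem_maddoxLinf_iff hq).1 hy
  refine mem_maddoxLinf_of_le_mul hq hqb (C := max C C') (D := 2) (hC.trans (le_max_left _ _))
    fun n => ?_
  have h1 : C ^ (1 / q n) ≤ (max C C') ^ (1 / q n) :=
    Real.rpow_le_rpow (by linarith) (le_max_left _ _) (one_div_nonneg.2 (hq n).le)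
  have h2 : C' ^ (1 / q n) ≤ (max C C') ^ (1 / q n) :=
    Real.rpow_le_rpow (by linarith) (le_max_right _ _) (one_div_nonneg.2 (hq n).le)
  linarith [abs_add_le (x n) (y n), hx n, hy n]

lemma maddoxLinf_smul {q : ℕ → ℝ} (hq : ∀ n, 0 < q n) (hqb : BddAbove (Set.range q))
    {x : ℕ → ℝ} (c : ℝ) (hx : x ∈ maddoxLinf q) :
    (fun k => c * x k) ∈ maddoxLinf q := by
  obtain ⟨C, hC, hx⟩ := (mem_maddoxLinf_iff hq).1 hx
  refine mem_maddoxLinf_of_le_mul hq hqb (C := C) (D := |c|) hC fun n => ?_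
  rw [abs_mul]
  exact mul_le_mul_of_nonneg_left (hx n) (abs_nonneg _)

lemma single_mem_maddoxC0 {p : ℕ → ℝ} (hp : ∀ k, 0 < p k) (k : ℕ) :
    (Pi.single k 1 : ℕ → ℝ) ∈ maddoxC0 p := by
  refine tendsto_const_nhds.congr' ?_
  filter_upwards [eventually_gt_atTop k] with j hj
  rw [Pi.single_eq_of_ne hj.ne', abs_zero, Real.zero_rpow (hp j).ne']

lemma maddoxC0_subset_maddoxC (p : ℕ → ℝ) : maddoxC0 p ⊆ maddoxC p := fun x hx =>
  ⟨0, by simpa using (show Tendsto (fun k => |x k| ^ p k) atTop (𝓝 0) from hx)⟩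

lemma const_mem_maddoxC {p : ℕ → ℝ} (hp : ∀ k, 0 < p k) (l : ℝ) : (fun _ => l) ∈ maddoxC p :=
  ⟨l, tendsto_const_nhds.congr fun k => by rw [sub_self, abs_zero, Real.zero_rpow (hp k).ne']⟩

/-! ### Convergent series, and splitting off the constants. -/

lemma SeriesConvergesTo.unique {u : ℕ → ℝ} {s t : ℝ} (h : SeriesConvergesTo u s)
    (h' : SeriesConvergesTo u t) : s = t := tendsto_nhds_unique h h'

lemma SeriesConvergesTo.add {u v : ℕ → ℝ} {s t : ℝ} (h : SeriesConvergesTo u s)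
    (h' : SeriesConvergesTo v t) : SeriesConvergesTo (fun k => u k + v k) (s + t) :=
  (Tendsto.add h h').congr fun _ => Finset.sum_add_distrib.symm

lemma SeriesConvergesTo.mul_left {u : ℕ → ℝ} {s : ℝ} (c : ℝ) (h : SeriesConvergesTo u s) :
    SeriesConvergesTo (fun k => c * u k) (c * s) :=
  (Tendsto.const_mul c h).congr fun _ => Finset.mul_sum _ _ _

lemma seriesConvergesTo_tsum {u : ℕ → ℝ} (h : Summable u) :
    SeriesConvergesTo u (∑' k, u k) := h.hasSum.tendsto_sum_nat

lemma seriesConvergesTo_single (a : ℕ → ℝ) (k : ℕ) :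
    SeriesConvergesTo (fun j => a j * (Pi.single k 1 : ℕ → ℝ) j) (a k) := by
  have : HasSum (fun j => a j * (Pi.single k 1 : ℕ → ℝ) j) (a k) := by
    convert hasSum_single k ?_ using 1
    · simp
    · intro j hj
      simp [hj]
  exact this.tendsto_sum_nat

/-- For a linear target, `(c(p) : Y)` is `(c₀(p) : Y)` plus a condition on the row sums. -/
lemma mem_matrixClass_maddoxC_iff {p : ℕ → ℝ} (hp : ∀ k, 0 < p k)
    {Y : Set (ℕ → ℝ)} (hadd : ∀ x ∈ Y, ∀ y ∈ Y, (fun n => x n + y n) ∈ Y)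
    (hsmul : ∀ c : ℝ, ∀ x ∈ Y, (fun n => c * x n) ∈ Y) {e : ℕ → ℕ → ℝ} :
    e ∈ matrixClass (maddoxC p) Y ↔
      e ∈ matrixClass (maddoxC0 p) Y ∧ ∃ s ∈ Y, ∀ n, SeriesConvergesTo (e n) (s n) := by
  constructor
  · intro h
    refine ⟨fun x hx => h x (maddoxC0_subset_maddoxC p hx), ?_⟩
    obtain ⟨s, hs, hs'⟩ := h _ (const_mem_maddoxC hp 1)
    exact ⟨s, hs, fun n => by simpa using hs' n⟩
  · rintro ⟨h, s, hs, hs'⟩ x ⟨l, hl⟩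
    obtain ⟨y, hy, hy'⟩ := h (fun k => x k - l) hl
    refine ⟨_, hadd _ hy _ (hsmul l _ hs), fun n => ?_⟩
    have := (hy' n).add ((hs' n).mul_left l)
    convert this using 2 with k
    ring

/-! ### Sufficient conditions for matrix maps on c₀(p). -/

/-- The homogeneous description with L = M: convergence of |y_k| M^{1/p_k} makes it bounded. This is
why M^{-1/p_k} is the right weight for the rows. -/
lemma exists_weight_bound {p : ℕ → ℝ} (hp : ∀ k, 0 < p k) (hpb : BddAbove (Set.range p))
    {y : ℕ → ℝ} (hy : y ∈ maddoxC0 p) {M : ℕ} (hM : 1 ≤ M) :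
    ∃ D : ℝ, 0 ≤ D ∧ ∀ k, |y k| ≤ D * (M : ℝ) ^ (-(1 / p k)) := by
  have hM0 : (0 : ℝ) < M := by exact_mod_cast hM
  obtain ⟨D, hD⟩ := ((mem_maddoxC0_iff hp hpb).1 hy M hM).bddAbove_range
  refine ⟨D, le_trans (by positivity) (hD ⟨0, rfl⟩), fun k => ?_⟩
  have : |y k| * (M : ℝ) ^ (1 / p k) ≤ D := hD ⟨k, rfl⟩
  rw [Real.rpow_neg hM0.le, ← div_eq_mul_inv, le_div_iff₀ (by positivity)]
  exact this

lemma summable_mul_of_mem_maddoxC0 {p : ℕ → ℝ} (hp : ∀ k, 0 < p k)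
    (hpb : BddAbove (Set.range p)) {a y : ℕ → ℝ} (hy : y ∈ maddoxC0 p) {M : ℕ} (hM : 1 ≤ M)
    (ha : Summable fun k => |a k| * (M : ℝ) ^ (-(1 / p k))) : Summable fun k => |a k * y k| := by
  obtain ⟨D, hD, h⟩ := exists_weight_bound hp hpb hy hM
  refine Summable.of_nonneg_of_le (fun k => abs_nonneg _) (fun k => ?_) (ha.mul_left D)
  rw [abs_mul]
  calc |a k| * |y k| ≤ |a k| * (D * (M : ℝ) ^ (-(1 / p k))) :=
        mul_le_mul_of_nonneg_left (h k) (abs_nonneg _)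
    _ = _ := by ring

lemma FiniteSumsBounded.exists_bound {e : ℕ → ℕ → ℝ} {p q : ℕ → ℝ} (hq : ∀ n, 0 < q n)
    (h : FiniteSumsBounded e p q) : ∃ M : ℕ, 1 ≤ M ∧ ∃ C : ℝ, 1 ≤ C ∧
      ∀ n, (Summable fun k => |e n k| * (M : ℝ) ^ (-(1 / p k))) ∧
        ∑' k, |e n k| * (M : ℝ) ^ (-(1 / p k)) ≤ C ^ (1 / q n) := by
  obtain ⟨M, hM, C, hC⟩ := h
  have key : ∀ (n : ℕ) (K : Finset ℕ),
      ∑ k ∈ K, |e n k| * (M : ℝ) ^ (-(1 / p k)) ≤ (max C 1) ^ (1 / q n) := fun n K =>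
    le_rpow_of_rpow_le (hq n) (Finset.sum_nonneg fun k _ => by positivity)
      ((hC n K).trans (le_max_left _ _))
  refine ⟨M, hM, max C 1, le_max_right _ _, fun n => ?_⟩
  have hs := summable_of_sum_le (fun k => by positivity) (key n)
  exact ⟨hs, hs.tsum_le_of_sum_le (key n)⟩

lemma abs_tsum_le_tsum_abs {a : ℕ → ℝ} (h : Summable fun k => |a k|) :
    |∑' k, a k| ≤ ∑' k, |a k| :=
  norm_tsum_le_tsum_norm (f := a) h

lemma FiniteSumsBounded.mem_matrixClass {e : ℕ → ℕ → ℝ} {p q : ℕ → ℝ} (hp : ∀ k, 0 < p k)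
    (hpb : BddAbove (Set.range p)) (hq : ∀ n, 0 < q n) (hqb : BddAbove (Set.range q))
    (h : FiniteSumsBounded e p q) : e ∈ matrixClass (maddoxC0 p) (maddoxLinf q) := by
  obtain ⟨M, hM, C, hC, hb⟩ := h.exists_bound hq
  intro y hy
  have hs := fun n => summable_mul_of_mem_maddoxC0 hp hpb hy hM (hb n).1
  have hs' : ∀ n, Summable fun k => e n k * y k := fun n => (hs n).of_abs
  refine ⟨fun n => ∑' k, e n k * y k, ?_, fun n => seriesConvergesTo_tsum (hs' n)⟩
  obtain ⟨D, hD, hyD⟩ := exists_weight_bound hp hpb hy hM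
  refine mem_maddoxLinf_of_le_mul hq hqb hC (D := D) fun n => ?_
  calc |∑' k, e n k * y k| ≤ ∑' k, |e n k * y k| := abs_tsum_le_tsum_abs (hs n)
    _ ≤ ∑' k, D * (|e n k| * (M : ℝ) ^ (-(1 / p k))) := by
        refine (hs n).tsum_le_tsum (fun k => ?_) ((hb n).1.mul_left D)
        rw [abs_mul]
        calc |e n k| * |y k| ≤ |e n k| * (D * (M : ℝ) ^ (-(1 / p k))) :=
              mul_le_mul_of_nonneg_left (hyD k) (abs_nonneg _)
          _ = _ := by ring
    _ = D * ∑' k, |e n k| * (M : ℝ) ^ (-(1 / p k)) := by rw [tsum_mul_left]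
    _ ≤ D * C ^ (1 / q n) := mul_le_mul_of_nonneg_left (hb n).2 hD

/-- A Toeplitz-type lemma: bounded row sums and null columns send null sequences to null
sequences. -/
lemma tendsto_tsum_mul_of_null_columns {b : ℕ → ℕ → ℝ} {v : ℕ → ℝ} (hb : ∀ n k, 0 ≤ b n k)
    (hv : ∀ k, 0 ≤ v k) (hsum : SupSumFinite b)
    (hcol : ∀ k, Tendsto (fun n => b n k) atTop (𝓝 0)) (hv0 : Tendsto v atTop (𝓝 0)) :
    Tendsto (fun n => ∑' k, b n k * v k) atTop (𝓝 0) := by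
  obtain ⟨C, hC⟩ := hsum
  have hC0 : 0 ≤ C := (tsum_nonneg (hb 0)).trans (hC 0).2
  rw [Metric.tendsto_atTop]
  intro ε hε
  set δ := ε / (2 * (C + 1)) with hδ
  have hδ0 : 0 < δ := by positivity
  obtain ⟨N, hN⟩ := eventually_atTop.1 (hv0.eventually (gt_mem_nhds hδ0))
  have hfin : Tendsto (fun n => ∑ k ∈ Finset.range N, b n k * v k) atTop (𝓝 0) := by
    have := tendsto_finsetSum (Finset.range N) fun k _ => (hcol k).mul_const (v k)
    simpa using this
  obtain ⟨n₀, hn₀⟩ := eventually_atTop.1 (hfin.eventually (gt_mem_nhds (half_pos hε)))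
  refine ⟨n₀, fun n hn => ?_⟩
  rw [Real.dist_eq, sub_zero, abs_of_nonneg (tsum_nonneg fun k => mul_nonneg (hb n k) (hv k))]
  have hle : ∀ k, b n k * v k ≤
      (if k ∈ Finset.range N then b n k * v k else 0) + δ * b n k := by
    intro k
    split_ifs with hk
    · linarith [mul_nonneg hδ0.le (hb n k)]
    · have := hN k (by simpa using hk)
      rw [zero_add, mul_comm]
      exact mul_le_mul_of_nonneg_right this.le (hb n k)
  have hf : HasSum (fun k => if k ∈ Finset.range N then b n k * v k else 0)
      (∑ k ∈ Finset.range N, b n k * v k) := by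
    have := hasSum_sum_of_ne_finset_zero (L := SummationFilter.unconditional ℕ)
      (s := Finset.range N)
      (f := fun k => if k ∈ Finset.range N then b n k * v k else 0)
      (fun k hk => if_neg hk)
    rwa [Finset.sum_congr rfl (fun k hk => if_pos hk)] at this
  have hs := hf.summable.add ((hC n).1.mul_left δ)
  have h1 : ∑' k, b n k * v k ≤ ∑ k ∈ Finset.range N, b n k * v k + δ * C := by
    calc ∑' k, b n k * v k ≤ _ := (Summable.of_nonneg_of_le
          (fun k => mul_nonneg (hb n k) (hv k)) hle hs).tsum_le_tsum hle hs
      _ = ∑ k ∈ Finset.range N, b n k * v k + δ * ∑' k, b n k := by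
          rw [hf.summable.tsum_add ((hC n).1.mul_left δ), hf.tsum_eq, tsum_mul_left]
      _ ≤ _ := by gcongr; exact (hC n).2
  have h2 : δ * C ≤ ε / 2 := by
    have : δ * (C + 1) = ε / 2 := by rw [hδ]; field_simp
    nlinarith
  linarith [hn₀ n hn]

/-- For each L the Toeplitz lemma applies to |e_{nk}| L^{1/q_n} M^{-1/p_k} and |y_k| M^{1/p_k}; the
powers of M cancel in the product. -/
lemma mem_matrixClass_maddoxC0 {e : ℕ → ℕ → ℝ} {p q : ℕ → ℝ} (hp : ∀ k, 0 < p k)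
    (hpb : BddAbove (Set.range p)) (hq : ∀ n, 0 < q n) (hqb : BddAbove (Set.range q))
    (hcol : ∀ k, Tendsto (fun n => |e n k| ^ q n) atTop (𝓝 0))
    (hsum : ∀ L : ℕ, 1 ≤ L → ∃ M : ℕ, 1 ≤ M ∧ SupSumFinite fun n k =>
      |e n k| * (L : ℝ) ^ (1 / q n) * (M : ℝ) ^ (-(1 / p k))) :
    e ∈ matrixClass (maddoxC0 p) (maddoxC0 q) := by
  intro y hy
  have hs : ∀ n, Summable fun k => |e n k * y k| := by
    intro n
    obtain ⟨M, hM, C, hC⟩ := hsum 1 le_rfl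
    refine summable_mul_of_mem_maddoxC0 hp hpb hy hM ?_
    simpa using (hC n).1
  have hs' : ∀ n, Summable fun k => e n k * y k := fun n => (hs n).of_abs
  refine ⟨fun n => ∑' k, e n k * y k, ?_, fun n => seriesConvergesTo_tsum (hs' n)⟩
  rw [mem_maddoxC0_iff hq hqb]
  intro L hL
  obtain ⟨M, hM, hMs⟩ := hsum L hL
  have hM0 : (0 : ℝ) < M := by exact_mod_cast hM
  have ht := tendsto_tsum_mul_of_null_columns (fun n k => by positivity)
    (v := fun k => |y k| * (M : ℝ) ^ (1 / p k)) (fun k => by positivity) hMs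
    (fun k => by
      have := ((mem_maddoxC0_iff hq hqb).1 (hcol k) L hL).mul_const ((M : ℝ) ^ (-(1 / p k)))
      simpa using this)
    ((mem_maddoxC0_iff hp hpb).1 hy M hM)
  refine squeeze_zero (fun n => by positivity) (fun n => ?_) ht
  have hrw : ∀ k, |e n k| * (L : ℝ) ^ (1 / q n) * (M : ℝ) ^ (-(1 / p k)) *
      (|y k| * (M : ℝ) ^ (1 / p k)) = |e n k * y k| * (L : ℝ) ^ (1 / q n) := by
    intro k
    rw [abs_mul, Real.rpow_neg hM0.le]
    have : (M : ℝ) ^ (1 / p k) ≠ 0 := by positivity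
    field_simp
  simp only [hrw]
  rw [tsum_mul_right]
  refine mul_le_mul_of_nonneg_right ?_ (by positivity)
  exact abs_tsum_le_tsum_abs (hs n)

/-! ### Null sequences as parameters for c₀(p), and uniform boundedness. -/

/-- The odd extension of `t ↦ t ^ r` from the non-negative reals. -/
def signedPow (r t : ℝ) : ℝ := (max t 0) ^ r - (max (-t) 0) ^ r

lemma continuous_signedPow {r : ℝ} (hr : 0 ≤ r) : Continuous (signedPow r) := by
  unfold signedPow
  exact ((continuous_id.max continuous_const).rpow_const fun _ => Or.inr hr).sub
    ((continuous_neg.max continuous_const).rpow_const fun _ => Or.inr hr)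

lemma signedPow_neg (r t : ℝ) : signedPow r (-t) = -signedPow r t := by
  simp [signedPow]

lemma signedPow_of_nonneg {r t : ℝ} (hr : 0 < r) (ht : 0 ≤ t) : signedPow r t = t ^ r := by
  rw [signedPow, max_eq_left ht, max_eq_right (by linarith), Real.zero_rpow hr.ne', sub_zero]

lemma abs_signedPow {r : ℝ} (hr : 0 < r) (t : ℝ) : |signedPow r t| = |t| ^ r := by
  rcases le_total 0 t with h | h
  · rw [signedPow_of_nonneg hr h, abs_of_nonneg h, abs_of_nonneg (by positivity)]
  · rw [← neg_neg t, signedPow_neg, signedPow_of_nonneg hr (by linarith), abs_neg, abs_neg,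
      abs_of_nonneg (by linarith : 0 ≤ -t),
      abs_of_nonneg (Real.rpow_nonneg (by linarith : 0 ≤ -t) _)]

/-- A null sequence as an element of the Banach space `C₀(ℕ, ℝ)`. -/
def nullSeq (u : ℕ → ℝ) (hu : Tendsto u atTop (𝓝 0)) : C₀(ℕ, ℝ) where
  toFun := u
  continuous_toFun := continuous_of_discreteTopology
  zero_at_infty' := by rwa [cocompact_eq_cofinite, Nat.cofinite_eq_atTop]

@[simp] lemma nullSeq_apply (u : ℕ → ℝ) (hu : Tendsto u atTop (𝓝 0)) (k : ℕ) :
    nullSeq u hu k = u k := rfl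

lemma tendsto_nullSeq (z : C₀(ℕ, ℝ)) : Tendsto (fun k => z k) atTop (𝓝 0) := by
  have := z.zero_at_infty'
  rwa [cocompact_eq_cofinite, Nat.cofinite_eq_atTop] at this

lemma nullSeq_dist_le_iff {z w : C₀(ℕ, ℝ)} {C : ℝ} (hC : 0 ≤ C) :
    dist z w ≤ C ↔ ∀ k, |z k - w k| ≤ C := by
  rw [← ZeroAtInftyContinuousMap.dist_toBCF_eq_dist, BoundedContinuousFunction.dist_le hC]
  rfl

lemma continuous_nullSeq_apply (k : ℕ) : Continuous fun z : C₀(ℕ, ℝ) => z k :=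
  (LipschitzWith.mk_one fun _ _ => (nullSeq_dist_le_iff dist_nonneg).1 le_rfl k).continuous

lemma signedPow_mem_maddoxC0 {p : ℕ → ℝ} (hp : ∀ k, 0 < p k) (z : C₀(ℕ, ℝ)) :
    (fun k => signedPow (1 / p k) (z k)) ∈ maddoxC0 p := by
  have h := (tendsto_nullSeq z).abs
  rw [abs_zero] at h
  refine h.congr fun k => ?_
  rw [abs_signedPow (one_div_pos.2 (hp k)), ← Real.rpow_mul (abs_nonneg _),
    one_div_mul_cancel (hp k).ne', Real.rpow_one]

/-- A uniform boundedness principle for functionals `z ↦ ∑ a_{ik} y_k`, where `y` runs through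
`c₀(p)`, parametrised by `y_k = signedPow (1 / p k) (z k)` with `z` a null sequence. -/
theorem exists_uniform_tail_bound {ι : Type*} {p : ℕ → ℝ} (hp : ∀ k, 0 < p k) {q : ι → ℝ}
    (hq : ∀ i, 0 < q i) (a : ι → ℕ → ℝ) (φ : ι → C₀(ℕ, ℝ) → ℝ) (hc : ∀ i, Continuous (φ i))
    (hφ : ∀ i z, SeriesConvergesTo (fun k => a i k * signedPow (1 / p k) (z k)) (φ i z))
    (hb : ∀ z, ∃ N : ℕ, ∀ i, |φ i z| ^ q i ≤ N) :
    ∃ M : ℕ, 1 ≤ M ∧ ∃ k₀ N : ℕ, ∀ (i : ι) (K : Finset ℕ), (∀ k ∈ K, k₀ ≤ k) →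
      ∑ k ∈ K, |a i k| * (M : ℝ) ^ (-(1 / p k)) ≤ (N : ℝ) ^ (1 / q i) := by
  have hcl : ∀ N : ℕ, IsClosed {z | ∀ i, |φ i z| ^ q i ≤ N} := by
    intro N
    rw [Set.ofPred_forall]
    exact isClosed_iInter fun i => isClosed_le
      ((hc i).abs.rpow_const fun _ => Or.inr (hq i).le) continuous_const
  have hU : ⋃ N : ℕ, {z | ∀ i, |φ i z| ^ q i ≤ N} = Set.univ :=
    Set.eq_univ_of_forall fun z => Set.mem_iUnion.2 (hb z)
  obtain ⟨N, z₀, hz₀⟩ := nonempty_interior_of_iUnion_of_closed hcl hU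
  obtain ⟨r, hr, hball⟩ := Metric.mem_nhds_iff.1 (mem_interior_iff_mem_nhds.1 hz₀)
  -- Past k₀ the centre is below δ, so replacing its entries there by ±δ moves it by at most 2δ =
  -- r/2 and stays in the ball.
  set δ := r / 4 with hδ
  have hδ0 : 0 < δ := by positivity
  have hz₀' := (tendsto_nullSeq z₀).abs
  rw [abs_zero] at hz₀'
  obtain ⟨k₀, hk₀⟩ := eventually_atTop.1 (hz₀'.eventually (gt_mem_nhds hδ0))
  obtain ⟨M, hM⟩ := exists_nat_gt (1 / δ)
  have hM0 : (0 : ℝ) < M := (by positivity : (0 : ℝ) < 1 / δ).trans hM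
  refine ⟨M, by exact_mod_cast hM0, k₀, N, fun i K hK => ?_⟩
  have hMδ : ∀ k, (M : ℝ) ^ (-(1 / p k)) ≤ δ ^ (1 / p k) := by
    intro k
    rw [Real.rpow_neg hM0.le, ← Real.inv_rpow hM0.le]
    refine Real.rpow_le_rpow (by positivity) ?_ (one_div_nonneg.2 (hp k).le)
    rw [inv_le_comm₀ hM0 hδ0, ← one_div]
    exact hM.le
  set σ : ℕ → ℝ := fun k => if 0 ≤ a i k then δ else -δ with hσ
  have hσabs : ∀ k, |σ k| = δ := by
    intro k
    simp only [hσ]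
    split_ifs
    · exact abs_of_pos hδ0
    · rw [abs_neg, abs_of_pos hδ0]
  have haσ : ∀ k, a i k * signedPow (1 / p k) (σ k) = |a i k| * δ ^ (1 / p k) := by
    intro k
    have h1 := signedPow_of_nonneg (one_div_pos.2 (hp k)) hδ0.le
    simp only [hσ]
    split_ifs with h
    · rw [h1, abs_of_nonneg h]
    · rw [signedPow_neg, h1, abs_of_neg (not_le.1 h)]; ring
  have hnull : ∀ v : ℕ → ℝ, Tendsto (fun k => if k ∈ K then v k else z₀ k) atTop (𝓝 0) := by
    intro v
    refine (tendsto_nullSeq z₀).congr' ?_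
    filter_upwards [eventually_gt_atTop (K.sup id)] with k hk
    rw [if_neg]
    intro hkK
    exact absurd (Finset.le_sup (f := id) hkK) (not_le.2 hk)
  have hmem : ∀ v : ℕ → ℝ, (∀ k, |v k| = δ) →
      |φ i (nullSeq _ (hnull v))| ≤ (N : ℝ) ^ (1 / q i) := by
    intro v hv
    refine le_rpow_of_rpow_le (hq i) (abs_nonneg _) (hball ?_ i)
    rw [Metric.mem_ball]
    refine lt_of_le_of_lt ((nullSeq_dist_le_iff (C := r / 2) (by positivity)).2 fun k => ?_)
      (half_lt_self hr)
    rw [nullSeq_apply]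
    split_ifs with h
    · have h1 := abs_sub (v k) (z₀ k)
      have h2 := hk₀ k (hK k h)
      rw [hv k] at h1
      linarith
    · rw [sub_self, abs_zero]; positivity
  have h₁ := hmem σ hσabs
  have h₂ := hmem (fun k => -σ k) fun k => by rw [abs_neg, hσabs]
  -- The two test points agree off K and are opposite on K, so the difference of the values is 2
  -- ∑_{k∈K} |a_{ik}| δ^{1/p_k}.
  have hd := (hφ i (nullSeq _ (hnull σ))).add
    ((hφ i (nullSeq _ (hnull fun k => -σ k))).mul_left (-1))
  have hfin : SeriesConvergesTo (fun k => if k ∈ K then 2 * (|a i k| * δ ^ (1 / p k)) else 0)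
      (∑ k ∈ K, 2 * (|a i k| * δ ^ (1 / p k))) := by
    have := hasSum_sum_of_ne_finset_zero (L := SummationFilter.unconditional ℕ) (s := K)
      (f := fun k => if k ∈ K then 2 * (|a i k| * δ ^ (1 / p k)) else 0)
      (fun k hk => if_neg hk)
    rw [Finset.sum_congr rfl (fun k hk => if_pos hk)] at this
    exact this.tendsto_sum_nat
  have heq : ∀ k, a i k * signedPow (1 / p k) (nullSeq _ (hnull σ) k) +
      -1 * (a i k * signedPow (1 / p k) (nullSeq _ (hnull fun k => -σ k) k)) =
      if k ∈ K then 2 * (|a i k| * δ ^ (1 / p k)) else 0 := by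
    intro k
    simp only [nullSeq_apply]
    split_ifs with h
    · rw [signedPow_neg, ← haσ]; ring
    · ring
  simp only [heq] at hd
  have hval := hfin.unique hd
  rw [← Finset.mul_sum] at hval
  have h3 := le_abs_self (φ i (nullSeq _ (hnull σ)))
  have h4 := neg_abs_le (φ i (nullSeq _ (hnull fun k => -σ k)))
  calc ∑ k ∈ K, |a i k| * (M : ℝ) ^ (-(1 / p k)) ≤ ∑ k ∈ K, |a i k| * δ ^ (1 / p k) :=
        Finset.sum_le_sum fun k _ => mul_le_mul_of_nonneg_left (hMδ k) (abs_nonneg _)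
    _ ≤ (N : ℝ) ^ (1 / q i) := by linarith

lemma sum_le_of_tail_sum_le {g : ℕ → ℝ} (hg : ∀ k, 0 ≤ g k) {k₀ : ℕ} {B : ℝ}
    (h : ∀ K : Finset ℕ, (∀ k ∈ K, k₀ ≤ k) → ∑ k ∈ K, g k ≤ B) (K : Finset ℕ) :
    ∑ k ∈ K, g k ≤ ∑ k ∈ Finset.range k₀, g k + B := by
  rw [← Finset.sum_filter_add_sum_filter_not K (fun k => k < k₀)]
  refine add_le_add (Finset.sum_le_sum_of_subset_of_nonneg ?_ fun k _ _ => hg k) (h _ ?_)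
  · intro k hk
    exact Finset.mem_range.2 (Finset.mem_filter.1 hk).2
  · intro k hk
    exact not_lt.1 (Finset.mem_filter.1 hk).2

/-- The `β`-dual of `c₀(p)`. -/
lemma exists_summable_weight {p : ℕ → ℝ} (hp : ∀ k, 0 < p k) {a : ℕ → ℝ}
    (h : ∀ y ∈ maddoxC0 p, ∃ s, SeriesConvergesTo (fun k => a k * y k) s) :
    ∃ M : ℕ, 1 ≤ M ∧ Summable fun k => |a k| * (M : ℝ) ^ (-(1 / p k)) := by
  -- The functionals are the partial sums, indexed by their length m: they are continuous as finite
  -- sums, and pointwise bounded because the series converges.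
  obtain ⟨M, hM, k₀, N, hN⟩ := exists_uniform_tail_bound hp (q := fun _ : ℕ => 1)
    (fun _ => one_pos) (fun m k => if k < m then a k else 0)
    (fun m z => ∑ k ∈ Finset.range m, a k * signedPow (1 / p k) (z k))
    (fun m => continuous_finsetSum _ fun k _ => continuous_const.mul
      ((continuous_signedPow (one_div_nonneg.2 (hp k).le)).comp (continuous_nullSeq_apply k)))
    (fun m z => by
      refine tendsto_const_nhds.congr' ?_
      filter_upwards [eventually_ge_atTop m] with n hn
      refine Finset.sum_subset_zero_on_sdiff (Finset.range_mono hn) ?_ ?_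
      · intro k hk
        rw [Finset.mem_sdiff, Finset.mem_range, Finset.mem_range] at hk
        simp [hk.2]
      · intro k hk
        rw [if_pos (Finset.mem_range.1 hk)])
    (fun z => by
      obtain ⟨s, hs⟩ := h _ (signedPow_mem_maddoxC0 hp z)
      obtain ⟨B, hB⟩ := (Tendsto.abs hs).bddAbove_range
      obtain ⟨N, hN⟩ := exists_nat_ge B
      refine ⟨N, fun m => ?_⟩
      rw [Real.rpow_one]
      exact (hB ⟨m, rfl⟩).trans hN)
  refine ⟨M, hM, summable_of_sum_le (fun k => by positivity)
    (sum_le_of_tail_sum_le (fun k => by positivity) (k₀ := k₀) (B := (N : ℝ) ^ (1 / (1 : ℝ)))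
      fun K hK => ?_)⟩
  refine le_trans (Finset.sum_le_sum fun k hk => ?_) (hN (K.sup id + 1) K hK)
  have hlt : k < K.sup id + 1 := Nat.lt_succ_of_le (Finset.le_sup (f := id) hk)
  rw [if_pos hlt]

/-- Near z₀, all but finitely many coordinates are at most 1/(2M) + 1/(2M) = 1/M in modulus, so the
given weighted series dominates those terms uniformly; the rest are bounded one by one. -/
lemma continuous_tsum_signedPow {p : ℕ → ℝ} (hp : ∀ k, 0 < p k) {a : ℕ → ℝ} {M : ℕ}
    (hM : 1 ≤ M) (ha : Summable fun k => |a k| * (M : ℝ) ^ (-(1 / p k))) :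
    Continuous fun z : C₀(ℕ, ℝ) => ∑' k, a k * signedPow (1 / p k) (z k) := by
  have hM0 : (0 : ℝ) < M := by exact_mod_cast hM
  rw [continuous_iff_continuousAt]
  intro z₀
  set ρ : ℝ := 1 / (2 * M) with hρ
  have hρ0 : 0 < ρ := by positivity
  have hz₀ := (tendsto_nullSeq z₀).abs
  rw [abs_zero] at hz₀
  obtain ⟨k₀, hk₀⟩ := eventually_atTop.1 (hz₀.eventually (gt_mem_nhds hρ0))
  have hsum : Summable fun k => |a k| * (M : ℝ) ^ (-(1 / p k)) +
      (if k ∈ Finset.range k₀ then |a k| * (|z₀ k| + ρ) ^ (1 / p k) else 0) :=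
    ha.add (summable_of_ne_finset_zero (s := Finset.range k₀) fun k hk => if_neg hk)
  refine (continuousOn_tsum (s := Metric.ball z₀ ρ) (fun k => ?_) hsum fun k z hz => ?_).continuousAt
    (Metric.ball_mem_nhds z₀ hρ0)
  · exact (continuous_const.mul ((continuous_signedPow (one_div_nonneg.2 (hp k).le)).comp
      (continuous_nullSeq_apply k))).continuousOn
  · have hzk : |z k - z₀ k| ≤ ρ :=
      (nullSeq_dist_le_iff hρ0.le).1 (Metric.mem_ball.1 hz).le k
    have hzk' : |z k| ≤ |z₀ k| + ρ := by
      have := abs_sub_abs_le_abs_sub (z k) (z₀ k)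
      linarith
    rw [norm_mul, Real.norm_eq_abs, Real.norm_eq_abs, abs_signedPow (one_div_pos.2 (hp k))]
    by_cases hk : k ∈ Finset.range k₀
    · rw [if_pos hk]
      have h1 := mul_le_mul_of_nonneg_left
        (Real.rpow_le_rpow (abs_nonneg _) hzk' (one_div_nonneg.2 (hp k).le)) (abs_nonneg (a k))
      have h2 : 0 ≤ |a k| * (M : ℝ) ^ (-(1 / p k)) := by positivity
      linarith
    · rw [if_neg hk, add_zero, Real.rpow_neg hM0.le, ← Real.inv_rpow hM0.le]
      refine mul_le_mul_of_nonneg_left (Real.rpow_le_rpow (abs_nonneg _) ?_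
        (one_div_nonneg.2 (hp k).le)) (abs_nonneg _)
      have h1 := hk₀ k (by simpa using hk)
      have h2 : ρ + ρ = (M : ℝ)⁻¹ := by rw [hρ]; field_simp; norm_num
      linarith

/-! ### Characterisation of the classes from c₀(p) to the three targets. -/

theorem finiteSumsBounded_of_mem_matrixClass {p q : ℕ → ℝ} (hp : ∀ k, 0 < p k)
    (hpb : BddAbove (Set.range p)) (hq : ∀ n, 0 < q n) (hqb : BddAbove (Set.range q)) {e : ℕ → ℕ → ℝ}
    (h : e ∈ matrixClass (maddoxC0 p) (maddoxLinf q)) : FiniteSumsBounded e p q := by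
  have hrow : ∀ n, ∃ M : ℕ, 1 ≤ M ∧ Summable fun k => |e n k| * (M : ℝ) ^ (-(1 / p k)) :=
    fun n => exists_summable_weight hp fun y hy => by
      obtain ⟨s, -, hs⟩ := h y hy
      exact ⟨s n, hs n⟩
  have hconv : ∀ n (z : C₀(ℕ, ℝ)), SeriesConvergesTo
      (fun k => e n k * signedPow (1 / p k) (z k)) (∑' k, e n k * signedPow (1 / p k) (z k)) := by
    intro n z
    obtain ⟨M, hM, hs⟩ := hrow n
    have := summable_mul_of_mem_maddoxC0 hp hpb (signedPow_mem_maddoxC0 hp z) hM hs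
    exact seriesConvergesTo_tsum this.of_abs
  obtain ⟨M, hM, k₀, N, hN⟩ := exists_uniform_tail_bound hp hq e
    (fun n z => ∑' k, e n k * signedPow (1 / p k) (z k))
    (fun n => by
      obtain ⟨M, hM, hs⟩ := hrow n
      exact continuous_tsum_signedPow hp hM hs)
    hconv
    (fun z => by
      obtain ⟨s, ⟨B, hB⟩, hs'⟩ := h _ (signedPow_mem_maddoxC0 hp z)
      obtain ⟨N, hN⟩ := exists_nat_ge B
      refine ⟨N, fun n => ?_⟩
      rw [(hconv n z).unique (hs' n)]
      exact (hB ⟨n, rfl⟩).trans hN)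
  -- The category argument controls only k ≥ k₀; the finitely many earlier columns are handled by
  -- unit sequences.
  have hcol : ∀ m, (fun n => ∑ k ∈ Finset.range m, |e n k| * (M : ℝ) ^ (-(1 / p k))) ∈
      maddoxLinf q := by
    intro m
    induction m with
    | zero =>
      refine ⟨0, ?_⟩
      rintro _ ⟨n, rfl⟩
      simp [Real.zero_rpow (hq n).ne']
    | succ m ih =>
      simp only [Finset.sum_range_succ]
      refine maddoxLinf_add hq hqb ih ?_
      obtain ⟨s, ⟨B, hB⟩, hs'⟩ := h _ (single_mem_maddoxC0 hp m)
      have habs : (fun n => |e n m|) ∈ maddoxLinf q := by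
        refine ⟨B, ?_⟩
        rintro _ ⟨n, rfl⟩
        have := hB ⟨n, rfl⟩
        simp only [abs_abs]
        rwa [(seriesConvergesTo_single (e n) m).unique (hs' n)]
      have := maddoxLinf_smul hq hqb ((M : ℝ) ^ (-(1 / p m))) habs
      simpa only [mul_comm] using this
  have hN' : (fun n => (N : ℝ) ^ (1 / q n)) ∈ maddoxLinf q := by
    refine ⟨N, ?_⟩
    rintro _ ⟨n, rfl⟩
    exact rpow_le_of_abs_le (hq n) (Nat.cast_nonneg N) (abs_of_nonneg (by positivity)).le
  obtain ⟨C, hC⟩ := maddoxLinf_add hq hqb (hcol k₀) hN'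
  refine ⟨M, hM, C, fun n K => le_trans ?_ (hC ⟨n, rfl⟩)⟩
  refine Real.rpow_le_rpow (Finset.sum_nonneg fun k _ => by positivity) ?_ (hq n).le
  exact (sum_le_of_tail_sum_le (fun k => by positivity) (hN n) K).trans (le_abs_self _)

theorem mem_matrixClass_maddoxLinf_iff {p q : ℕ → ℝ} (hp : ∀ k, 0 < p k)
    (hpb : BddAbove (Set.range p)) (hq : ∀ n, 0 < q n) (hqb : BddAbove (Set.range q))
    {e : ℕ → ℕ → ℝ} :
    e ∈ matrixClass (maddoxC0 p) (maddoxLinf q) ↔ FiniteSumsBounded e p q :=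
  ⟨finiteSumsBounded_of_mem_matrixClass hp hpb hq hqb, fun h => h.mem_matrixClass hp hpb hq hqb⟩

lemma exists_supSumFinite {p : ℕ → ℝ} (hp : ∀ k, 0 < p k) (hpb : BddAbove (Set.range p))
    {e : ℕ → ℕ → ℝ}
    (h : ∀ y ∈ maddoxC0 p, ∃ s : ℕ → ℝ, BddAbove (Set.range fun n => |s n|) ∧
      ∀ n, SeriesConvergesTo (fun k => e n k * y k) (s n)) :
    ∃ M : ℕ, 1 ≤ M ∧ SupSumFinite fun n k => |e n k| * (M : ℝ) ^ (-(1 / p k)) := by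
  have hmem : e ∈ matrixClass (maddoxC0 p) (maddoxLinf fun _ => 1) := by
    intro y hy
    obtain ⟨s, hs, hs'⟩ := h y hy
    exact ⟨s, by simpa [maddoxLinf] using hs, hs'⟩
  obtain ⟨M, hM, C, -, hC⟩ := (finiteSumsBounded_of_mem_matrixClass hp hpb (fun _ => one_pos)
    ⟨1, by rintro _ ⟨_, rfl⟩; exact le_rfl⟩ hmem).exists_bound fun _ => one_pos
  exact ⟨M, hM, C, fun n => ⟨(hC n).1, by simpa using (hC n).2⟩⟩

theorem mem_matrixClass_maddoxC0_iff {p q : ℕ → ℝ} (hp : ∀ k, 0 < p k)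
    (hpb : BddAbove (Set.range p)) (hq : ∀ n, 0 < q n) (hqb : BddAbove (Set.range q))
    {e : ℕ → ℕ → ℝ} :
    e ∈ matrixClass (maddoxC0 p) (maddoxC0 q) ↔
      (∀ k, Tendsto (fun n => |e n k| ^ q n) atTop (𝓝 0)) ∧
      ∀ L : ℕ, 1 ≤ L → ∃ M : ℕ, 1 ≤ M ∧ SupSumFinite fun n k =>
        |e n k| * (L : ℝ) ^ (1 / q n) * (M : ℝ) ^ (-(1 / p k)) := by
  refine ⟨fun h => ⟨fun k => ?_, fun L hL => ?_⟩, fun h =>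
    mem_matrixClass_maddoxC0 hp hpb hq hqb h.1 h.2⟩
  · obtain ⟨s, hs, hs'⟩ := h _ (single_mem_maddoxC0 hp k)
    have heq : s = fun n => e n k :=
      funext fun n => (hs' n).unique (seriesConvergesTo_single (e n) k)
    rw [heq] at hs
    exact hs
  -- Multiplying row n by L^{1/q_n} sends c₀(p) into bounded sequences, by the homogeneous
  -- description of c₀(q).
  · obtain ⟨M, hM, hs⟩ := exists_supSumFinite hp hpb (e := fun n k => (L : ℝ) ^ (1 / q n) * e n k)
      fun y hy => by
        obtain ⟨s, hs, hs'⟩ := h y hy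
        refine ⟨fun n => (L : ℝ) ^ (1 / q n) * s n, ?_, fun n => ?_⟩
        · refine (((mem_maddoxC0_iff hq hqb).1 hs L hL).congr fun n => ?_).bddAbove_range
          rw [abs_mul, abs_of_nonneg (by positivity : 0 ≤ (L : ℝ) ^ (1 / q n)), mul_comm]
        · simpa only [mul_assoc] using (hs' n).mul_left ((L : ℝ) ^ (1 / q n))
    refine ⟨M, hM, ?_⟩
    convert hs using 4 with n k
    rw [abs_mul, abs_of_nonneg (by positivity : 0 ≤ (L : ℝ) ^ (1 / q n)), mul_comm]

/-- With α the column limits, the limit of the transform of y must be ∑ α_k y_k. Subtracting α from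
every row therefore reduces the target to c₀(q). -/
theorem mem_matrixClass_maddoxC0_maddoxC_iff {p q : ℕ → ℝ} (hp : ∀ k, 0 < p k)
    (hpb : BddAbove (Set.range p)) (hq : ∀ n, 0 < q n) (hqb : BddAbove (Set.range q))
    {e : ℕ → ℕ → ℝ} :
    e ∈ matrixClass (maddoxC0 p) (maddoxC q) ↔
      (∃ α : ℕ → ℝ, (∀ k, Tendsto (fun n => |e n k - α k| ^ q n) atTop (𝓝 0)) ∧
        ∀ L : ℕ, 1 ≤ L → ∃ M : ℕ, 1 ≤ M ∧ SupSumFinite fun n k =>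
          |e n k - α k| * (L : ℝ) ^ (1 / q n) * (M : ℝ) ^ (-(1 / p k))) ∧
      ∃ M : ℕ, 1 ≤ M ∧ SupSumFinite fun n k => |e n k| * (M : ℝ) ^ (-(1 / p k)) := by
  constructor
  · intro h
    have h9 : ∃ M : ℕ, 1 ≤ M ∧ SupSumFinite fun n k => |e n k| * (M : ℝ) ^ (-(1 / p k)) :=
      exists_supSumFinite hp hpb fun y hy => by
        obtain ⟨s, hs, hs'⟩ := h y hy
        obtain ⟨l, hl⟩ := tendsto_of_mem_maddoxC hq hqb hs
        exact ⟨s, hl.abs.bddAbove_range, hs'⟩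
    have hcol : ∀ k, ∃ a, Tendsto (fun n => |e n k - a| ^ q n) atTop (𝓝 0) := by
      intro k
      obtain ⟨s, ⟨a, ha⟩, hs'⟩ := h _ (single_mem_maddoxC0 hp k)
      have heq : s = fun n => e n k :=
        funext fun n => (hs' n).unique (seriesConvergesTo_single (e n) k)
      rw [heq] at ha
      exact ⟨a, ha⟩
    choose α hα using hcol
    have hα' : ∀ k, Tendsto (fun n => e n k - α k) atTop (𝓝 0) := fun k =>
      tendsto_zero_of_mem_maddoxC0 hq hqb (hα k)
    refine ⟨⟨α, ?_⟩, h9⟩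
    rw [← mem_matrixClass_maddoxC0_iff (e := fun n k => e n k - α k) hp hpb hq hqb]
    obtain ⟨M, hM, C, hC⟩ := h9
    have hM0 : (0 : ℝ) < M := by exact_mod_cast hM
    -- A Fatou-type step: the uniform row bound passes to the limit in finite sums.
    have hαK : ∀ K : Finset ℕ, ∑ k ∈ K, |α k| * (M : ℝ) ^ (-(1 / p k)) ≤ C := by
      intro K
      refine le_of_tendsto' (tendsto_finsetSum K fun k _ =>
        (tendsto_sub_nhds_zero_iff.1 (hα' k)).abs.mul_const _) fun n => ?_
      exact ((hC n).1.sum_le_tsum K fun k _ => by positivity).trans (hC n).2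
    have hαs : Summable fun k => |α k| * (M : ℝ) ^ (-(1 / p k)) :=
      summable_of_sum_le (fun k => by positivity) hαK
    have hbs : SupSumFinite fun n k => |e n k - α k| * (M : ℝ) ^ (-(1 / p k)) := by
      have hle : ∀ n k, |e n k - α k| * (M : ℝ) ^ (-(1 / p k)) ≤
          |e n k| * (M : ℝ) ^ (-(1 / p k)) + |α k| * (M : ℝ) ^ (-(1 / p k)) := by
        intro n k
        rw [← add_mul]
        exact mul_le_mul_of_nonneg_right (abs_sub _ _) (by positivity)
      have hs : ∀ n, Summable fun k => |e n k - α k| * (M : ℝ) ^ (-(1 / p k)) := fun n =>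
        Summable.of_nonneg_of_le (fun k => by positivity) (hle n) ((hC n).1.add hαs)
      refine ⟨C + C, fun n => ⟨hs n, ?_⟩⟩
      refine ((hs n).tsum_le_tsum (hle n) ((hC n).1.add hαs)).trans ?_
      rw [(hC n).1.tsum_add hαs]
      exact add_le_add (hC n).2 (hαs.tsum_le_of_sum_le hαK)
    intro y hy
    obtain ⟨s, ⟨l, hl⟩, hs'⟩ := h y hy
    have hsl : Tendsto (fun n => s n - l) atTop (𝓝 0) := tendsto_zero_of_mem_maddoxC0 hq hqb hl
    have hαy := (summable_mul_of_mem_maddoxC0 hp hpb hy hM hαs).of_abs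
    have hdiff : ∀ n, SeriesConvergesTo (fun k => (e n k - α k) * y k)
        (s n - ∑' k, α k * y k) := by
      intro n
      have := (hs' n).add ((seriesConvergesTo_tsum hαy).mul_left (-1))
      convert this using 2 with k
      · ring
      · ring
    have habs : ∀ n, Summable fun k => |(e n k - α k) * y k| := fun n =>
      summable_mul_of_mem_maddoxC0 hp hpb (a := fun k => e n k - α k) hy hM (hbs.choose_spec n).1
    have h0 : Tendsto (fun n => s n - ∑' k, α k * y k) atTop (𝓝 0) := by
      have ht := tendsto_tsum_mul_of_null_columns (fun n k => by positivity)
        (v := fun k => |y k| * (M : ℝ) ^ (1 / p k)) (fun k => by positivity) hbs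
        (fun k => by simpa using (hα' k).abs.mul_const ((M : ℝ) ^ (-(1 / p k))))
        ((mem_maddoxC0_iff hp hpb).1 hy M hM)
      refine squeeze_zero_norm (fun n => ?_) ht
      have hrw : ∀ k, |e n k - α k| * (M : ℝ) ^ (-(1 / p k)) *
          (|y k| * (M : ℝ) ^ (1 / p k)) = |(e n k - α k) * y k| := by
        intro k
        rw [abs_mul, Real.rpow_neg hM0.le]
        have : (M : ℝ) ^ (1 / p k) ≠ 0 := by positivity
        field_simp
      simp only [hrw]
      rw [(hdiff n).unique (seriesConvergesTo_tsum (habs n).of_abs)]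
      exact abs_tsum_le_tsum_abs (habs n)
    have hlim : ∑' k, α k * y k = l :=
      tendsto_nhds_unique (tendsto_sub_nhds_zero_iff.1 h0) (tendsto_sub_nhds_zero_iff.1 hsl)
    rw [hlim] at hdiff
    exact ⟨fun n => s n - l, hl, hdiff⟩
  · rintro ⟨⟨α, hα⟩, M₁, hM₁, C₁, hC₁⟩ y hy
    have hmem := mem_matrixClass_maddoxC0 (e := fun n k => e n k - α k) hp hpb hq hqb hα.1 hα.2
    obtain ⟨s, hs, hs'⟩ := hmem y hy
    -- Convergence of ∑ α_k y_k is read off from row 0, as α = e_0 - (e_0 - α).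
    have hey := (summable_mul_of_mem_maddoxC0 hp hpb hy hM₁ (hC₁ 0).1).of_abs
    have hαy : SeriesConvergesTo (fun k => α k * y k) (∑' k, e 0 k * y k + -1 * s 0) := by
      have := (seriesConvergesTo_tsum hey).add ((hs' 0).mul_left (-1))
      convert this using 2 with k
      ring
    refine ⟨fun n => s n + (∑' k, e 0 k * y k + -1 * s 0), ⟨∑' k, e 0 k * y k + -1 * s 0, ?_⟩, fun n => ?_⟩
    · simp only [add_sub_cancel_right]
      exact hs
    · have := (hs' n).add hαy
      convert this using 2 with k
      ring

/-! ### The Fibonacci transform and its inverse. -/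

lemma f_pos (n : ℕ) : 0 < f n := by
  unfold f
  exact_mod_cast Nat.fib_pos.2 n.succ_pos

lemma succ_le_two_mul_f (n : ℕ) : (n : ℝ) + 1 ≤ 2 * f n := by
  have h1 : n + 1 ≤ Nat.fib (n + 1) + 1 := Nat.le_fib_add_one _
  have h2 : 1 ≤ Nat.fib (n + 1) := Nat.fib_pos.2 n.succ_pos
  have h3 : n + 1 ≤ 2 * Nat.fib (n + 1) := by omega
  unfold f
  exact_mod_cast h3

/-- Linear growth of f suffices: f_k f_{k+1} ≥ (k+1)²/4. -/
lemma summable_fibWeight : Summable fun k => 1 / (f k * f (k + 1)) := by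
  have hs : Summable fun k : ℕ => 4 * (1 / ((k + 1 : ℕ) : ℝ) ^ 2) :=
    ((summable_nat_add_iff 1).2 (Real.summable_one_div_nat_pow.2 one_lt_two)).mul_left 4
  refine Summable.of_nonneg_of_le (fun k => ?_) (fun k => ?_) hs
  · have := f_pos k; have := f_pos (k + 1); positivity
  · have h1 := succ_le_two_mul_f k
    have h2 := succ_le_two_mul_f (k + 1)
    push_cast at h2 ⊢
    rw [mul_one_div, div_le_div_iff₀ (mul_pos (f_pos _) (f_pos _)) (by positivity)]
    have h3 : ((k : ℝ) + 1) * (k + 1) ≤ (2 * f k) * (2 * f (k + 1)) :=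
      mul_le_mul h1 (by linarith) (by positivity) (by have := f_pos k; positivity)
    nlinarith

/-- Dividing the n-th entry of the transform by f_n f_{n+1} gives x_n/f_{n+1}² - x_{n-1}/f_n², which
telescopes. -/
lemma eq_sum_fibTransform (x : ℕ → ℝ) (n : ℕ) :
    x n = f (n + 1) ^ 2 * ∑ k ∈ Finset.range (n + 1), 1 / (f k * f (k + 1)) * fibTransform x k := by
  induction n with
  | zero =>
    have h0 := (f_pos 0).ne'
    have h1 := (f_pos 1).ne'
    simp [fibTransform, f]
  | succ n ih =>
    have h0 := (f_pos n).ne'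
    have h1 := (f_pos (n + 1)).ne'
    have h2 := (f_pos (n + 2)).ne'
    rw [Finset.sum_range_succ]
    have h3 : ∑ k ∈ Finset.range (n + 1), 1 / (f k * f (k + 1)) * fibTransform x k
        = x n / f (n + 1) ^ 2 := by
      rw [eq_div_iff (by positivity), mul_comm]; exact ih.symm
    rw [h3]
    simp only [fibTransform]
    field_simp
    ring

lemma fibTransform_surjective (y : ℕ → ℝ) : ∃ x, fibTransform x = y := by
  refine ⟨fun n => f (n + 1) ^ 2 * ∑ k ∈ Finset.range (n + 1), 1 / (f k * f (k + 1)) * y k, ?_⟩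
  funext n
  cases n with
  | zero => simp [fibTransform, f]
  | succ n =>
    have h0 := (f_pos n).ne'
    have h1 := (f_pos (n + 1)).ne'
    have h2 := (f_pos (n + 2)).ne'
    simp only [fibTransform]
    rw [Finset.sum_range_succ _ (n + 1)]
    field_simp
    ring

/-! ### Abel summation and transfer from c(F̂,p) to c(p). -/

/-- The partial sums of `∑_j f_{j+1}² a_{nj}`. -/
def rowPartialSum (A : ℕ → ℕ → ℝ) (n k : ℕ) : ℝ :=
  ∑ j ∈ Finset.range k, f (j + 1) ^ 2 * A n j

lemma partialE_eq (A : ℕ → ℕ → ℝ) (n : ℕ) {m k : ℕ} (h : k ≤ m) :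
    partialE A n m k =
      (rowPartialSum A n (m + 1) - rowPartialSum A n k) * (1 / (f k * f (k + 1))) := by
  unfold partialE rowPartialSum
  rw [← Finset.sum_Ico_eq_sub _ (by omega : k ≤ m + 1), Finset.sum_mul]
  have : Finset.Icc k m = Finset.Ico k (m + 1) := by ext; simp
  rw [this]
  exact Finset.sum_congr rfl fun j _ => by ring

lemma tendsto_partialE {A : ℕ → ℕ → ℝ} {n : ℕ} {S : ℝ}
    (h : Tendsto (rowPartialSum A n) atTop (𝓝 S)) (k : ℕ) :
    Tendsto (fun m => partialE A n m k) atTop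
      (𝓝 ((S - rowPartialSum A n k) * (1 / (f k * f (k + 1))))) := by
  refine ((((tendsto_add_atTop_iff_nat 1).2 h).sub_const _).mul_const _).congr' ?_
  filter_upwards [eventually_ge_atTop k] with m hm
  exact (partialE_eq A n hm).symm

lemma limitE_eq {A : ℕ → ℕ → ℝ} {n : ℕ} {S : ℝ}
    (h : Tendsto (rowPartialSum A n) atTop (𝓝 S)) (k : ℕ) :
    limitE A n k = (S - rowPartialSum A n k) * (1 / (f k * f (k + 1))) :=
  (tendsto_partialE h k).limUnder_eq

/-- Column 0 already decides: f_0 f_1 = 1, so e^{(n)}_{m0} is the row partial sum of length m + 1,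
and the other columns differ from it by a constant and a factor. -/
lemma columnLimits_iff {A : ℕ → ℕ → ℝ} :
    ColumnLimits A ↔ ∀ n, ∃ S, Tendsto (rowPartialSum A n) atTop (𝓝 S) := by
  constructor
  · intro h n
    obtain ⟨α, hα⟩ := h n
    refine ⟨α 0, ?_⟩
    rw [← tendsto_add_atTop_iff_nat 1]
    have h0 := tendsto_sub_nhds_zero_iff.1 ((tendsto_zero_iff_abs_tendsto_zero _).2 (hα 0))
    refine h0.congr fun m => ?_
    rw [partialE_eq A n (Nat.zero_le m)]
    simp [rowPartialSum, f]
  · intro h n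
    obtain ⟨S, hS⟩ := h n
    refine ⟨fun k => (S - rowPartialSum A n k) * (1 / (f k * f (k + 1))), fun k => ?_⟩
    exact (tendsto_zero_iff_abs_tendsto_zero _).1
      (tendsto_sub_nhds_zero_iff.2 (tendsto_partialE hS k))

lemma sum_mul_eq (A : ℕ → ℕ → ℝ) (n : ℕ) (x : ℕ → ℝ) (N : ℕ) :
    ∑ j ∈ Finset.range N, A n j * x j =
      rowPartialSum A n N * ∑ k ∈ Finset.range N, 1 / (f k * f (k + 1)) * fibTransform x k -
      ∑ k ∈ Finset.range N,
        rowPartialSum A n k * (1 / (f k * f (k + 1))) * fibTransform x k := by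
  induction N with
  | zero => simp
  | succ N ih =>
    have hx := eq_sum_fibTransform x N
    have hT : rowPartialSum A n (N + 1) = rowPartialSum A n N + f (N + 1) ^ 2 * A n N :=
      Finset.sum_range_succ _ _
    rw [Finset.sum_range_succ (fun j => A n j * x j), ih, hx, hT,
      Finset.sum_range_succ (fun k => 1 / (f k * f (k + 1)) * fibTransform x k),
      Finset.sum_range_succ
        (fun k => rowPartialSum A n k * (1 / (f k * f (k + 1))) * fibTransform x k)]
    ring

/-- Once the limits `e_{nk}` exist, `∑ a_{nj} x_j` and `∑ e_{nk} (F̂x)_k` have the same sum. -/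
lemma seriesConvergesTo_iff {A : ℕ → ℕ → ℝ} {n : ℕ} {S : ℝ}
    (h : Tendsto (rowPartialSum A n) atTop (𝓝 S)) {x : ℕ → ℝ} {l : ℝ}
    (hx : Tendsto (fibTransform x) atTop (𝓝 l)) (s : ℝ) :
    SeriesConvergesTo (fun j => A n j * x j) s ↔
      SeriesConvergesTo (fun k => limitE A n k * fibTransform x k) s := by
  obtain ⟨B, hB⟩ := hx.norm.bddAbove_range
  have hY : Summable fun k => 1 / (f k * f (k + 1)) * fibTransform x k := by
    refine Summable.of_norm_bounded (summable_fibWeight.mul_right B) fun k => ?_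
    have h0 : 0 ≤ 1 / (f k * f (k + 1)) :=
      one_div_nonneg.2 (mul_pos (f_pos k) (f_pos (k + 1))).le
    rw [norm_mul, Real.norm_of_nonneg h0]
    exact mul_le_mul_of_nonneg_left (hB ⟨k, rfl⟩) h0
  have hd : Tendsto (fun N => ∑ j ∈ Finset.range N, A n j * x j -
      ∑ k ∈ Finset.range N, limitE A n k * fibTransform x k) atTop (𝓝 0) := by
    have h1 := (tendsto_sub_nhds_zero_iff.2 h).mul hY.hasSum.tendsto_sum_nat
    rw [zero_mul] at h1
    refine h1.congr fun N => ?_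
    rw [sum_mul_eq]
    simp only [limitE_eq h]
    rw [sub_mul, Finset.mul_sum _ _ S, sub_sub, sub_right_inj, ← Finset.sum_add_distrib]
    exact Finset.sum_congr rfl fun k _ => by ring
  unfold SeriesConvergesTo
  constructor
  · intro h2
    simpa using h2.sub hd
  · intro h2
    simpa using hd.add h2

lemma mem_matrixClass_fibC_iff {p : ℕ → ℝ} (hp : ∀ k, 0 < p k) (hpb : BddAbove (Set.range p))
    {Y : Set (ℕ → ℝ)} {A : ℕ → ℕ → ℝ} :
    A ∈ matrixClass (fibC p) Y ↔ ColumnLimits A ∧ limitE A ∈ matrixClass (maddoxC p) Y := by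
  constructor
  · intro h
    have hcol : ∀ n, ∃ S, Tendsto (rowPartialSum A n) atTop (𝓝 S) := by
      intro n
      -- This test sequence is x_j = f_{j+1}², whose series has exactly `rowPartialSum` as partial
      -- sums.
      obtain ⟨x, hx⟩ := fibTransform_surjective (Pi.single 0 1)
      have hxc : x ∈ fibC p := by
        show fibTransform x ∈ maddoxC p
        rw [hx]
        exact maddoxC0_subset_maddoxC p (single_mem_maddoxC0 hp 0)
      obtain ⟨y, -, hy⟩ := h x hxc
      refine ⟨y n, (hy n).congr fun N => Finset.sum_congr rfl fun j _ => ?_⟩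
      have h1 : ∑ k ∈ Finset.range (j + 1), 1 / (f k * f (k + 1)) * fibTransform x k = 1 := by
        rw [hx, Finset.sum_eq_single 0]
        · simp [f]
        · intro k _ hk
          simp [hk]
        · simp
      simp only [eq_sum_fibTransform x j, h1]
      ring
    refine ⟨columnLimits_iff.2 hcol, fun z hz => ?_⟩
    obtain ⟨x, rfl⟩ := fibTransform_surjective z
    obtain ⟨y, hy, hy'⟩ := h x hz
    obtain ⟨l, hl⟩ := tendsto_of_mem_maddoxC hp hpb hz
    exact ⟨y, hy, fun n => (seriesConvergesTo_iff (hcol n).choose_spec hl _).1 (hy' n)⟩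
  · rintro ⟨hcol, h⟩ x hx
    rw [columnLimits_iff] at hcol
    obtain ⟨y, hy, hy'⟩ := h _ hx
    obtain ⟨l, hl⟩ := tendsto_of_mem_maddoxC hp hpb hx
    exact ⟨y, hy, fun n => (seriesConvergesTo_iff (hcol n).choose_spec hl _).2 (hy' n)⟩

lemma partialE_eq_limitE_sub {A : ℕ → ℕ → ℝ} {n : ℕ} {S : ℝ}
    (h : Tendsto (rowPartialSum A n) atTop (𝓝 S)) {m k : ℕ} (hk : k ≤ m) :
    partialE A n m k =
      limitE A n k - (S - rowPartialSum A n (m + 1)) * (1 / (f k * f (k + 1))) := by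
  rw [partialE_eq A n hk, limitE_eq h]
  ring

/-- A section differs from its limit by (S - T(m+1)) w_k, where the first factor is bounded in m, w
is summable and M^{-1/p_k} ≤ 1. -/
lemma partialBounded_of_summable {A : ℕ → ℕ → ℝ} {p : ℕ → ℝ} (hp : ∀ k, 0 < p k)
    (hA : ColumnLimits A)
    (h : ∀ n, ∃ M : ℕ, 1 ≤ M ∧ Summable fun k => |limitE A n k| * (M : ℝ) ^ (-(1 / p k))) :
    PartialBounded A p := by
  intro n
  obtain ⟨S, hS⟩ := columnLimits_iff.1 hA n
  obtain ⟨M, hM, hs⟩ := h n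
  obtain ⟨B, hB⟩ := (((tendsto_add_atTop_iff_nat 1).2 hS).const_sub S).abs.bddAbove_range
  have hB0 : 0 ≤ B := (abs_nonneg _).trans (hB ⟨0, rfl⟩)
  refine ⟨M, hM, ∑' k, |limitE A n k| * (M : ℝ) ^ (-(1 / p k)) +
    B * ∑' k, 1 / (f k * f (k + 1)), ?_⟩
  rintro _ ⟨m, rfl⟩
  have hw0 : ∀ k, 0 ≤ 1 / (f k * f (k + 1)) := fun k =>
    one_div_nonneg.2 (mul_pos (f_pos k) (f_pos (k + 1))).le
  calc ∑ k ∈ Finset.range (m + 1), |partialE A n m k| * (M : ℝ) ^ (-(1 / p k))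
      ≤ ∑ k ∈ Finset.range (m + 1), (|limitE A n k| * (M : ℝ) ^ (-(1 / p k)) +
          B * (1 / (f k * f (k + 1)))) := by
        refine Finset.sum_le_sum fun k hk => ?_
        have hM1 : (M : ℝ) ^ (-(1 / p k)) ≤ 1 :=
          Real.rpow_le_one_of_one_le_of_nonpos (by exact_mod_cast hM)
            (neg_nonpos.2 (one_div_nonneg.2 (hp k).le))
        have hM0 : 0 ≤ (M : ℝ) ^ (-(1 / p k)) := by positivity
        have hBm : |S - rowPartialSum A n (m + 1)| ≤ B := hB ⟨m, rfl⟩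
        rw [partialE_eq_limitE_sub hS (Nat.lt_succ_iff.1 (Finset.mem_range.1 hk))]
        have h1 := abs_sub (limitE A n k)
          ((S - rowPartialSum A n (m + 1)) * (1 / (f k * f (k + 1))))
        rw [abs_mul (S - _), abs_of_nonneg (hw0 k)] at h1
        have h2 := mul_le_mul_of_nonneg_right hBm (hw0 k)
        have h3 : 0 ≤ B * (1 / (f k * f (k + 1))) := mul_nonneg hB0 (hw0 k)
        refine (mul_le_mul_of_nonneg_right (h1.trans (add_le_add_right h2 _)) hM0).trans ?_
        rw [add_mul]
        have h4 := mul_le_of_le_one_right h3 hM1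
        linarith
    _ ≤ _ := by
        rw [Finset.sum_add_distrib, ← Finset.mul_sum]
        refine add_le_add (hs.sum_le_tsum _ fun k _ => by positivity)
          (mul_le_mul_of_nonneg_left (summable_fibWeight.sum_le_tsum _ fun k _ => hw0 k) hB0)

/-- For fixed n the factor L^{1/q_n} is a constant. -/
lemma PartialBounded.weighted {A : ℕ → ℕ → ℝ} {p : ℕ → ℝ} (h : PartialBounded A p)
    (q : ℕ → ℝ) : PartialBoundedWeighted A p q := by
  intro n L _
  obtain ⟨M, hM, B, hB⟩ := h n
  refine ⟨M, hM, B * (L : ℝ) ^ (1 / q n), ?_⟩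
  rintro _ ⟨m, rfl⟩
  refine le_trans (le_of_eq ?_)
    (mul_le_mul_of_nonneg_right (hB ⟨m, rfl⟩) (by positivity : 0 ≤ (L : ℝ) ^ (1 / q n)))
  simp only [Finset.sum_mul]
  exact Finset.sum_congr rfl fun k _ => by ring

/-- Summed over k ≤ m, the correction is S - T(m+1) times a partial sum of ∑ w_k, hence vanishes in
the limit. -/
lemma partialRowSums_of_seriesConvergesTo {A : ℕ → ℕ → ℝ} (hA : ColumnLimits A)
    (h : ∀ n, ∃ s, SeriesConvergesTo (limitE A n) s) : PartialRowSums A := by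
  intro n
  obtain ⟨S, hS⟩ := columnLimits_iff.1 hA n
  obtain ⟨s, hs⟩ := h n
  refine ⟨s, (tendsto_zero_iff_abs_tendsto_zero _).1 (tendsto_sub_nhds_zero_iff.2 ?_)⟩
  have h1 := (tendsto_add_atTop_iff_nat 1).2
    (Tendsto.sub hs ((hS.const_sub S).mul summable_fibWeight.hasSum.tendsto_sum_nat))
  rw [sub_self, zero_mul, sub_zero] at h1
  refine h1.congr fun m => ?_
  rw [Finset.mul_sum, ← Finset.sum_sub_distrib]
  exact Finset.sum_congr rfl fun k hk =>
    (partialE_eq_limitE_sub hS (Nat.lt_succ_iff.1 (Finset.mem_range.1 hk))).symm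

/-- The conditions on the sections `e^{(n)}_{mk}` that follow from the summability conditions on
the limits `e_{nk}`. -/
lemma partial_conditions {A : ℕ → ℕ → ℝ} {p q : ℕ → ℝ} (hp : ∀ k, 0 < p k)
    {Y : Set (ℕ → ℝ)} (hA : ColumnLimits A)
    (h0 : limitE A ∈ matrixClass (maddoxC p) Y) :
    PartialBounded A p ∧ PartialBoundedWeighted A p q ∧ PartialRowSums A := by
  have hb : PartialBounded A p := partialBounded_of_summable hp hA fun n =>
    exists_summable_weight hp fun y hy => by
      obtain ⟨s, -, hs⟩ := h0 y (maddoxC0_subset_maddoxC p hy)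
      exact ⟨s n, hs n⟩
  refine ⟨hb, hb.weighted q, partialRowSums_of_seriesConvergesTo hA fun n => ?_⟩
  obtain ⟨s, -, hs⟩ := h0 _ (const_mem_maddoxC hp 1)
  exact ⟨s n, by simpa using hs n⟩

/-- The class `(c(F̂,p) : Y)` for a linear target `Y`, in terms of the limits `e_{nk}`. -/
lemma mem_matrixClass_fibC_iff_limitE {A : ℕ → ℕ → ℝ} {p : ℕ → ℝ} (q : ℕ → ℝ)
    (hp : ∀ k, 0 < p k) (hpb : BddAbove (Set.range p)) {Y : Set (ℕ → ℝ)}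
    (hadd : ∀ x ∈ Y, ∀ y ∈ Y, (fun n => x n + y n) ∈ Y)
    (hsmul : ∀ c : ℝ, ∀ x ∈ Y, (fun n => c * x n) ∈ Y) :
    A ∈ matrixClass (fibC p) Y ↔
      ColumnLimits A ∧ PartialBounded A p ∧ PartialBoundedWeighted A p q ∧ PartialRowSums A ∧
      limitE A ∈ matrixClass (maddoxC0 p) Y ∧
      ∃ s : ℕ → ℝ, (∀ n, SeriesConvergesTo (limitE A n) (s n)) ∧ s ∈ Y := by
  rw [mem_matrixClass_fibC_iff hp hpb]
  constructor
  · rintro ⟨hA, h⟩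
    obtain ⟨h2, h3, h4⟩ := partial_conditions (q := q) hp hA h
    obtain ⟨h5, s, hs, hs'⟩ := (mem_matrixClass_maddoxC_iff hp hadd hsmul).1 h
    exact ⟨hA, h2, h3, h4, h5, s, hs', hs⟩
  · rintro ⟨hA, -, -, -, h5, s, hs', hs⟩
    exact ⟨hA, (mem_matrixClass_maddoxC_iff hp hadd hsmul).2 ⟨h5, s, hs, hs'⟩⟩

end FibSeq

end

theorem theorem3p4 (p q : ℕ → ℝ)
    (hp : ∀ k, 0 < p k) (hpb : BddAbove (Set.range p))
    (hq : ∀ n, 0 < q n) (hqm : Monotone q) (hqb : BddAbove (Set.range q))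
    (A : ℕ → ℕ → ℝ) :
    (A ∈ FibSeq.matrixClass (FibSeq.fibC p) (FibSeq.maddoxLinf q) ↔
      FibSeq.ColumnLimits A ∧ FibSeq.PartialBounded A p ∧
      FibSeq.PartialBoundedWeighted A p q ∧ FibSeq.PartialRowSums A ∧
      FibSeq.FiniteSumsBounded (FibSeq.limitE A) p q ∧
      (∃ s : ℕ → ℝ, (∀ n, FibSeq.SeriesConvergesTo (FibSeq.limitE A n) (s n)) ∧
        BddAbove (Set.range fun n => |s n| ^ q n))) ∧
    (A ∈ FibSeq.matrixClass (FibSeq.fibC p) (FibSeq.maddoxC0 q) ↔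
      FibSeq.ColumnLimits A ∧ FibSeq.PartialBounded A p ∧
      FibSeq.PartialBoundedWeighted A p q ∧ FibSeq.PartialRowSums A ∧
      (∀ k, Tendsto (fun n => |FibSeq.limitE A n k| ^ q n) atTop (𝓝 0)) ∧
      (∀ L : ℕ, 1 ≤ L → ∃ M : ℕ, 1 ≤ M ∧ FibSeq.SupSumFinite fun n k =>
        |FibSeq.limitE A n k| * (L : ℝ) ^ (1 / q n) * (M : ℝ) ^ (-(1 / p k))) ∧
      (∃ s : ℕ → ℝ, (∀ n, FibSeq.SeriesConvergesTo (FibSeq.limitE A n) (s n)) ∧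
        Tendsto (fun n => |s n| ^ q n) atTop (𝓝 0))) ∧
    (A ∈ FibSeq.matrixClass (FibSeq.fibC p) (FibSeq.maddoxC q) ↔
      FibSeq.ColumnLimits A ∧ FibSeq.PartialBounded A p ∧
      FibSeq.PartialBoundedWeighted A p q ∧ FibSeq.PartialRowSums A ∧
      (∃ α : ℕ → ℝ,
        (∀ k, Tendsto (fun n => |FibSeq.limitE A n k - α k| ^ q n) atTop (𝓝 0)) ∧
        (∀ L : ℕ, 1 ≤ L → ∃ M : ℕ, 1 ≤ M ∧ FibSeq.SupSumFinite fun n k =>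
          |FibSeq.limitE A n k - α k| * (L : ℝ) ^ (1 / q n) * (M : ℝ) ^ (-(1 / p k)))) ∧
      (∃ M : ℕ, 1 ≤ M ∧ FibSeq.SupSumFinite fun n k =>
        |FibSeq.limitE A n k| * (M : ℝ) ^ (-(1 / p k))) ∧
      (∃ s : ℕ → ℝ, (∀ n, FibSeq.SeriesConvergesTo (FibSeq.limitE A n) (s n)) ∧
        ∃ α : ℝ, Tendsto (fun n => |s n - α| ^ q n) atTop (𝓝 0))) := by
  refine ⟨?_, ?_, ?_⟩
  · rw [FibSeq.mem_matrixClass_fibC_iff_limitE q hp hpb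
      (fun x hx y hy => FibSeq.maddoxLinf_add hq hqb hx hy)
      (fun c x hx => FibSeq.maddoxLinf_smul hq hqb c hx),
      FibSeq.mem_matrixClass_maddoxLinf_iff hp hpb hq hqb]
    rfl
  · rw [FibSeq.mem_matrixClass_fibC_iff_limitE q hp hpb
      (fun x hx y hy => FibSeq.maddoxC0_add hq hqb hx hy)
      (fun c x hx => FibSeq.maddoxC0_smul hq hqb c hx),
      FibSeq.mem_matrixClass_maddoxC0_iff hp hpb hq hqb, and_assoc]
    rfl
  · rw [FibSeq.mem_matrixClass_fibC_iff_limitE q hp hpb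
      (fun x hx y hy => FibSeq.maddoxC_add hq hqb hx hy)
      (fun c x hx => FibSeq.maddoxC_smul hq hqb c hx),
      FibSeq.mem_matrixClass_maddoxC0_maddoxC_iff hp hpb hq hqb, and_assoc]
    rfl
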